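/- Let $\mathcal S=[a,b]$ and $\mathcal T=[c,d]$ be compact intervals in $\mathbb R$ with $a<b$ and $c<d$, and let $\mu\in L^2(\mathcal S\times\mathcal T)$ be real-valued. Put $$k_1(s_1,s_2)=\int_{\mathcal T}\mu(s_1,t)\mu(s_2,t)\,dt,\qquad k_2(t_1,t_2)=\int_{\mathcal S}\mu(s,t_1)\mu(s,t_2)\,ds .$$ A nonzero $\phi\in L^2(\mathcal S)$ is called an eigenfunction of $k_1$ with eigenvalue $\lambda$ if $\int_{\mathcal S}k_1(s,u)\phi(u)\,du=\lambda\phi(s)$ for almost every $s\in\mathcal S$; eigenfunctions of $k_2$ in $L^2(\mathcal T)$ are defined in the same way. Then there exist a (finite, possibly empty, or infinite) non-increasing sequence of positive numbers $(\lambda_k)_{k\ge1}$, an orthonormal sequence $(\phi_k)_{k\ge1}$ in $L^2(\mathcal S)$ and an orthonormal sequence $(\psi_k)_{k\ge1}$ in $L^2(\mathcal T)$, with the same index set, such that for each $k$ the function $\phi_k$ is an eigenfunction of $k_1$ and $\psi_k$ is an eigenfunction of $k_2$, both with eigenvalue $\lambda_k$, and $$k_1(s_1,s_2)=\sum_{k}\lambda_k\phi_k(s_1)\phi_k(s_2),\qquad(1)$$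 $$k_2(t_1,t_2)=\sum_{k}\lambda_k\psi_k(t_1)\psi_k(t_2),\qquad(2)$$ $$\mu(s,t)=\sum_{k}\lambda_k^{1/2}\phi_k(s)\psi_k(t),\qquad(3)$$ where the series converge in the norm of $L^2(\mathcal S\times\mathcal S)$, $L^2(\mathcal T\times\mathcal T)$ and $L^2(\mathcal S\times\mathcal T)$, respectively. The sequences can moreover be chosen so that the following holds. If in addition $\mu$ is continuous on $\mathcal S\times\mathcal T$, then all $\phi_k$ and $\psi_k$ are continuous, and the series (1) and (2) converge absolutely and uniformly in both variables (also the series of absolute values converge uniformly), with the identities (1) and (2) holding for every $(s_1,s_2)\in\mathcal S\times\mathcal S$ and every $(t_1,t_2)\in\mathcal T\times\mathcal T$. If, furthermore, the series in (3) converges uniformly on $\mathcal S\times\mathcal T$ and absolutely at each point, then (3) holds for every $(s,t)\in\mathcal S\times\mathcal T$. -/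

import Mathlib

open MeasureTheory Set Filter Topology

namespace FSVD

noncomputable section

/-- The kernel `k₁(s₁, s₂) = ∫_T μ(s₁, t) μ(s₂, t) dt`. -/
def kernelOne (μ : ℝ → ℝ → ℝ) (T : Set ℝ) (s₁ s₂ : ℝ) : ℝ :=
  ∫ t in T, μ s₁ t * μ s₂ t

/-- The kernel `k₂(t₁, t₂) = ∫_S μ(s, t₁) μ(s, t₂) ds`. -/
def kernelTwo (μ : ℝ → ℝ → ℝ) (S : Set ℝ) (t₁ t₂ : ℝ) : ℝ :=
  ∫ s in S, μ s t₁ * μ s t₂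

/-- `f ∈ L²(I)` is a (nonzero) eigenfunction, with eigenvalue `c`, of the kernel `κ` on `I`:
`∫_I κ(x, y) f(y) dy = c f(x)` for almost every `x ∈ I`, the integrand being integrable. -/
structure IsEigenfunction (κ : ℝ → ℝ → ℝ) (I : Set ℝ) (c : ℝ) (f : ℝ → ℝ) : Prop where
  memLp : MemLp f 2 (volume.restrict I)
  ne_zero : ¬ f =ᵐ[volume.restrict I] 0
  eigen : ∀ᵐ x ∂(volume.restrict I),
    Integrable (fun y => κ x y * f y) (volume.restrict I) ∧ ∫ y in I, κ x y * f y = c * f x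

/-- The (finite or infinite) sequence `(f k)`, `k < N`, is orthonormal in `L²(I)`. -/
structure IsOrthonormalSeq (N : ℕ∞) (f : ℕ → ℝ → ℝ) (I : Set ℝ) : Prop where
  memLp : ∀ k : ℕ, (k : ℕ∞) < N → MemLp (f k) 2 (volume.restrict I)
  inner_eq : ∀ j k : ℕ, (j : ℕ∞) < N → (k : ℕ∞) < N →
    ∫ x in I, f j x * f k x = if j = k then 1 else 0

/-- The `n`-th partial sum of the (finite or infinite) series `∑_{k < N} f k`. -/
def partialSum {X : Type*} (N : ℕ∞) (f : ℕ → X → ℝ) (n : ℕ) (x : X) : ℝ :=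
  ∑ k ∈ (Finset.range n).filter (fun k : ℕ => (k : ℕ∞) < N), f k x

/-- `F ∈ L²(A)`, and the series `∑_{k < N} f k` converges to `F` in the norm of `L²(A)`. -/
def SeriesConvergesL2 (N : ℕ∞) (f : ℕ → ℝ × ℝ → ℝ) (F : ℝ × ℝ → ℝ) (A : Set (ℝ × ℝ)) : Prop :=
  MemLp F 2 (volume.restrict A) ∧
    Tendsto (fun n => eLpNorm (fun p => F p - partialSum N f n p) 2 (volume.restrict A))
      atTop (𝓝 0)

/-- The series `∑_{k < N} f k` converges to `F` uniformly on `A` (in particular at every point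
of `A`). -/
def SeriesConvergesUniformlyTo {X : Type*} (N : ℕ∞) (f : ℕ → X → ℝ) (F : X → ℝ) (A : Set X) :
    Prop :=
  TendstoUniformlyOn (partialSum N f) F atTop A

/-- The series `∑_{k < N} f k` converges absolutely at every point of `A`. -/
def SeriesConvergesAbsolutely {X : Type*} (N : ℕ∞) (f : ℕ → X → ℝ) (A : Set X) : Prop :=
  ∀ x ∈ A, ∃ b : ℝ, Tendsto (fun n => partialSum N (fun k y => |f k y|) n x) atTop (𝓝 b)

end

end FSVD

/-!
Integration against `μ` defines a bounded operator `A : L²(T) → L²(S)`, `kernelOp`, depending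
linearly and boundedly on `μ ∈ L²(S × T)`. A kernel is determined by its operator
(`eq_zero_of_kernelOp_eq_zero`); consequently the products `u(s) v(t)` span a dense subspace of
`L²(S × T)`, and since they give operators of rank one, every `A` is compact. The spectral theorem
for `A† A` yields orthonormal eigenvectors `v k` with positive eigenvalues `lam k`, and
`u k = lam k ^ (-1/2) A (v k)` is orthonormal as well. Bessel's inequality for the orthonormal
family `u k ⊗ v k` in `L²(S × T)` gives `∑ lam k ≤ ‖μ‖²`, so the eigenvalues can be listed in
non-increasing order (`exists_isSingularSystem`).

All three `L²` expansions come from one fact, `hasSum_tensor_of_kernelOp`: a kernel whose operator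
is diagonal with respect to two orthonormal families is the sum of its diagonal expansion, since
the difference of the two kernels has operator zero. For `k₁` and `k₂` it is used with `A A†` and
`A† A`. The construction is symmetric in the two variables, so each statement about `k₂` is the
statement about `k₁` for the transposed kernel.

Singular functions are represented by `φ k s = lam k ^ (-1/2) ∫ μ(s, t) v k t dt`. If `μ` is
continuous, they are continuous, and every section `μ(s, ·)` lies in the closed span of the
`v k`, because `s ↦ ∫ μ(s, t) w t dt` is continuous and vanishes almost everywhere for `w` orthogonal to
the `v k`. Parseval's identity for two sections is then the expansion of `k₁` at every
point (`hasSum_kernelOne`), and Dini's theorem on the diagonal gives the uniform convergence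
(`tendstoUniformlyOn_sum_mul`). Finally a uniform limit of the expansion of `μ`
is continuous on each section and agrees almost everywhere with `μ(s, ·)`, hence everywhere.
-/

namespace FSVD

/-! ### Enumerating a family in decreasing order -/

/-- A positive family with finitely many members above each positive level can be enumerated in
non-increasing order. The position of an index is the number of its predecessors in the order that
compares values first and breaks ties by a well-ordering; `N` is the supremum of the
positions plus one. -/
theorem exists_antitone_enumeration {ι : Type*} (l : ι → ℝ) (hpos : ∀ i, 0 < l i)
    (hfin : ∀ ε : ℝ, 0 < ε → {i | ε ≤ l i}.Finite) :
    ∃ (N : ℕ∞) (e : {k : ℕ // (k : ℕ∞) < N} ≃ ι), ∀ j k, j ≤ k → l (e k) ≤ l (e j) := by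
  classical
  let _ : LinearOrder ι := IsWellOrder.linearOrder (WellOrderingRel (α := ι))
  let g : ι → ℝᵒᵈ ×ₗ ι := fun i => toLex (OrderDual.toDual (l i), i)
  have hg : Function.Injective g := fun i j h => by
    have := congrArg (fun z => (ofLex z).2) h
    exact this
  let R : ι → Set ι := fun i => {j | g j < g i}
  have hle : ∀ i j, g j ≤ g i → l i ≤ l j := fun i j h => by
    rcases (Prod.Lex.le_iff.1 h) with h | h
    · exact le_of_lt h
    · exact le_of_eq (congrArg OrderDual.ofDual h.1).symm
  have hR : ∀ i, (R i).Finite := fun i =>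
    (hfin (l i) (hpos i)).subset fun j hj => hle i j (le_of_lt hj)
  let r : ι → ℕ := fun i => (R i).ncard
  have hr : ∀ i j, g i < g j → r i < r j := fun i j h =>
    Set.ncard_lt_ncard ⟨fun k hk => lt_trans hk h, fun hs =>
      lt_irrefl (g i) (hs (show i ∈ R j from h))⟩ (hR j)
  have hr' : ∀ i j, r i ≤ r j → g i ≤ g j := fun i j h => by
    by_contra hc
    exact absurd (hr j i (not_le.1 hc)) (not_lt.2 h)
  have hinj : Function.Injective r := fun i j h =>
    hg (le_antisymm (hr' i j h.le) (hr' j i h.ge))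
  have hdown : ∀ i m, m < r i → ∃ j, r j = m := fun i m hm => by
    have h1 : r '' R i ⊆ Set.Iio (r i) := by
      rintro _ ⟨j, hj, rfl⟩
      exact hr j i hj
    -- `r` maps the `r i` predecessors of `i` injectively into the `r i` numbers below `r i`.
    have h2 : r '' R i = Set.Iio (r i) := by
      refine Set.eq_of_subset_of_ncard_le h1 ?_ (Set.finite_Iio _)
      rw [Set.ncard_image_of_injective _ hinj, Set.ncard_eq_toFinset_card']
      simp [r]
    have h3 : m ∈ r '' R i := by rw [h2]; exact hm
    obtain ⟨j, -, hj⟩ := h3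
    exact ⟨j, hj⟩
  let N : ℕ∞ := ⨆ i, ((r i : ℕ∞) + 1)
  have hN : ∀ k : ℕ, (k : ℕ∞) < N ↔ ∃ i, r i = k := fun k => by
    constructor
    · intro h
      obtain ⟨i, hi⟩ := lt_iSup_iff.1 h
      have hi' : k ≤ r i := Nat.lt_succ_iff.1 (by exact_mod_cast hi)
      rcases hi'.lt_or_eq with h | h
      · exact hdown i k h
      · exact ⟨i, h.symm⟩
    · rintro ⟨i, rfl⟩
      exact lt_iSup_iff.2 ⟨i, by exact_mod_cast Nat.lt_succ_self _⟩
  let f : ι → {k : ℕ // (k : ℕ∞) < N} := fun i => ⟨r i, (hN _).2 ⟨i, rfl⟩⟩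
  have hf : Function.Bijective f := by
    refine ⟨fun i j h => hinj (congrArg Subtype.val h), fun ⟨k, hk⟩ => ?_⟩
    obtain ⟨i, hi⟩ := (hN k).1 hk
    exact ⟨i, Subtype.ext hi⟩
  refine ⟨N, (Equiv.ofBijective f hf).symm, fun j k hjk => ?_⟩
  obtain ⟨j, rfl⟩ := hf.2 j
  obtain ⟨k, rfl⟩ := hf.2 k
  have e1 : ∀ i, (Equiv.ofBijective f hf).symm (f i) = i := fun i =>
    (Equiv.ofBijective f hf).symm_apply_apply i
  rw [e1, e1]
  exact hle k j (hr' j k hjk)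

/-! ### Orthonormal families in Hilbert spaces -/

section Hilbert

universe u

variable {ι : Type*} {E : Type u} {F : Type*}
  [NormedAddCommGroup E] [InnerProductSpace ℝ E] [CompleteSpace E]
  [NormedAddCommGroup F] [InnerProductSpace ℝ F] [CompleteSpace F]

theorem exists_hasSum_inner_smul {f : ι → E} (hf : Orthonormal ℝ f) (x : E) :
    ∃ g, HasSum (fun i => inner ℝ (f i) x • f i) g ∧ ∀ i, inner ℝ (f i) (x - g) = 0 := by
  classical
  have hs : Summable (fun i => inner ℝ (f i) x • f i) :=
    (hf.orthogonalFamily.summable_iff_norm_sq_summable fun i => inner ℝ (f i) x).2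
      (hf.inner_products_summable x)
  refine ⟨_, hs.hasSum, fun i => ?_⟩
  have h1 := (innerSL ℝ (f i)).hasSum hs.hasSum
  have h2 : HasSum (fun j => innerSL ℝ (f i) (inner ℝ (f j) x • f j)) (inner ℝ (f i) x) := by
    convert! hasSum_ite_eq i (inner ℝ (f i) x) using 2 with j
    rw [innerSL_apply_apply, inner_smul_right, orthonormal_iff_ite.1 hf]
    by_cases h : j = i
    · subst h; simp
    · simp [h, Ne.symm h]
  rw [inner_sub_right, h2.unique h1]
  exact sub_self _

/-- The Fourier series of `x` along an orthonormal family sums to `x` as soon as `x` is orthogonal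
to the orthogonal complement of the family. -/
theorem hasSum_inner_smul_of_orthogonal {f : ι → E} (hf : Orthonormal ℝ f) (x : E)
    (hx : ∀ w, (∀ i, inner ℝ (f i) w = 0) → inner ℝ x w = 0) :
    HasSum (fun i => inner ℝ (f i) x • f i) x := by
  obtain ⟨g, hg, h0⟩ := exists_hasSum_inner_smul hf x
  have h1 : inner ℝ x (x - g) = 0 := hx _ h0
  have h2 : inner ℝ g (x - g) = 0 := by
    have h3 := (innerSL ℝ (x - g)).hasSum hg
    have h4 : (fun i => innerSL ℝ (x - g) (inner ℝ (f i) x • f i)) = fun _ => 0 := by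
      funext i
      rw [innerSL_apply_apply, inner_smul_right, real_inner_comm (f i) (x - g), h0, mul_zero]
    rw [real_inner_comm]
    exact (h3.unique (h4 ▸ hasSum_zero))
  have h5 : x - g = 0 := by
    rw [← inner_self_eq_zero (𝕜 := ℝ), inner_sub_left, h1, h2, sub_zero]
  rwa [← sub_eq_zero.1 h5] at hg

/-- A compact operator `A` has an orthonormal family of eigenvectors of `A† A` with positive
eigenvalues whose orthogonal complement is annihilated by `A`: collect orthonormal bases of the
eigenspaces of `A† A`. -/
theorem exists_orthonormal_eigenvectors (A : E →L[ℝ] F) (hA : IsCompactOperator A) :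
    ∃ (κ : Type u) (l : κ → ℝ) (v : κ → E), Orthonormal ℝ v ∧ (∀ i, 0 < l i) ∧
      (∀ i, A.adjoint (A (v i)) = l i • v i) ∧
      ∀ w, (∀ i, inner ℝ (v i) w = 0) → A w = 0 := by
  let T : E →L[ℝ] E := A.adjoint ∘L A
  have hT : IsCompactOperator T := hA.clm_comp A.adjoint
  have hS : T.IsSymmetric := fun x y => by
    simp [T, ContinuousLinearMap.adjoint_inner_left, ContinuousLinearMap.adjoint_inner_right]
  have hTin : ∀ x, inner ℝ (T x) x = ‖A x‖ ^ 2 := fun x => by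
    simp [T, ContinuousLinearMap.adjoint_inner_left]
  have hker : ∀ x, T x = 0 → A x = 0 := fun x hx => by
    have := hTin x
    rw [hx, inner_zero_left] at this
    simpa using this.symm
  let V : ℝ → Submodule ℝ E := fun c => Module.End.eigenspace (T : Module.End ℝ E) c
  have hV : ∀ c x, x ∈ V c ↔ T x = c • x := fun c x => Module.End.mem_eigenspace_iff
  have hcl : ∀ c, IsClosed (V c : Set E) := fun c => by
    have : (V c : Set E) = {x | T x = c • x} := by ext x; exact hV c x
    rw [this]
    exact isClosed_eq T.continuous (continuous_id.const_smul c)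
  have : ∀ c, CompleteSpace (V c) := fun c => (hcl c).completeSpace_coe
  choose w b _ using fun c => exists_hilbertBasis ℝ (V c)
  have hon : Orthonormal ℝ (fun a : Σ c : ℝ, w c => ((b a.1 a.2 : V a.1) : E)) :=
    (hS.orthogonalFamily_eigenspaces).orthonormal_sigma_orthonormal
      (v_family := fun c i => b c i) (fun c => (b c).orthonormal)
  refine ⟨{a : Σ c : ℝ, w c // 0 < a.1}, fun a => a.1.1,
    fun a => ((b a.1.1 a.1.2 : V a.1.1) : E), hon.comp _ Subtype.coe_injective,
    fun a => a.2, fun a => (hV _ _).1 (b a.1.1 a.1.2).2, fun x hx => ?_⟩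
  -- `T x` is orthogonal to every eigenspace, hence zero.
  have key : ∀ c, ∀ y ∈ V c, inner ℝ y (T x) = 0 := by
    intro c y hy
    have e1 : inner ℝ y (T x) = c * inner ℝ y x := by
      have := hS y x
      change inner ℝ (T y) x = inner ℝ y (T x) at this
      rw [← this]
      rw [(hV c y).1 hy, inner_smul_left]
      rfl
    rcases lt_trichotomy c 0 with hc | hc | hc
    · -- `⟪T y, y⟫ = ‖A y‖ ^ 2` excludes negative eigenvalues.
      have h1 := hTin y
      rw [(hV c y).1 hy, inner_smul_left, real_inner_self_eq_norm_sq] at h1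
      have h2 : ‖y‖ ^ 2 = 0 := by
        have h3 : (0 : ℝ) ≤ c * ‖y‖ ^ 2 := by
          have : (0 : ℝ) ≤ ‖A y‖ ^ 2 := by positivity
          rw [← h1] at this
          exact this
        nlinarith [sq_nonneg ‖y‖]
      have : y = 0 := by simpa using h2
      simp [this]
    · rw [e1, hc, zero_mul]
    · rw [e1]
      -- `x` is orthogonal to the basis of the eigenspace, hence to the expansion of `y` in it.
      have h1 := ((innerSL ℝ x).comp (V c).subtypeL).hasSum ((b c).hasSum_repr ⟨y, hy⟩)
      have h2 : ∀ i, ((innerSL ℝ x).comp (V c).subtypeL)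
          ((b c).repr ⟨y, hy⟩ i • b c i) = 0 := fun i => by
        have := hx ⟨⟨c, i⟩, hc⟩
        simp only [map_smul, ContinuousLinearMap.comp_apply, innerSL_apply_apply,
          Submodule.subtypeL_apply]
        rw [real_inner_comm, this, smul_zero]
      have h3 : inner ℝ x y = 0 := by
        simp only [h2] at h1
        exact h1.unique hasSum_zero
      rw [real_inner_comm, h3, mul_zero]
  apply hker
  have hmem : T x ∈ (⨆ c, Module.End.eigenspace (T : Module.End ℝ E) c)ᗮ := by
    rw [Submodule.iSup_eq_span, Submodule.mem_orthogonal]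
    intro u hu
    induction hu using Submodule.span_induction with
    | mem y hy => obtain ⟨c, hc⟩ := Set.mem_iUnion.1 hy; exact key c y hc
    | zero => simp
    | add y z _ _ h1 h2 => rw [inner_add_left, h1, h2, add_zero]
    | smul a y _ h1 => rw [inner_smul_left, h1, mul_zero]
  rw [ContinuousLinearMap.orthogonalComplement_iSup_eigenspaces_eq_bot hT hS] at hmem
  simpa using hmem

end Hilbert

noncomputable section

/-! ### Tensor products and integral operators on `L²` -/

section Tensor

variable {X Y : Type*} [MeasurableSpace X] [MeasurableSpace Y]
  {ν : Measure X} {ρ : Measure Y}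

theorem memLp_tensor {u : X → ℝ} {v : Y → ℝ} (hu : MemLp u 2 ν) (hv : MemLp v 2 ρ) :
    MemLp (fun p : X × Y => u p.1 * v p.2) 2 (ν.prod ρ) := by
  refine (memLp_two_iff_integrable_sq (hu.1.comp_fst.mul hv.1.comp_snd)).2 ?_
  simp only [Pi.mul_apply, mul_pow]
  exact hu.integrable_sq.mul_prod hv.integrable_sq

theorem ae_comp_fst {u u' : X → ℝ} (h : u =ᵐ[ν] u') :
    (fun p : X × Y => u p.1) =ᵐ[ν.prod ρ] fun p => u' p.1 :=
  Measure.quasiMeasurePreserving_fst.ae_eq_comp h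

theorem ae_comp_snd {v v' : Y → ℝ} (h : v =ᵐ[ρ] v') :
    (fun p : X × Y => v p.2) =ᵐ[ν.prod ρ] fun p => v' p.2 :=
  Measure.quasiMeasurePreserving_snd.ae_eq_comp h

/-- The element `(x, y) ↦ u x * v y` of `L²(ν ⊗ ρ)`. -/
def tensor (u : Lp ℝ 2 ν) (v : Lp ℝ 2 ρ) : Lp ℝ 2 (ν.prod ρ) :=
  (memLp_tensor (Lp.memLp u) (Lp.memLp v)).toLp _

theorem coeFn_tensor (u : Lp ℝ 2 ν) (v : Lp ℝ 2 ρ) :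
    tensor u v =ᵐ[ν.prod ρ] fun p => u p.1 * v p.2 :=
  MemLp.coeFn_toLp _

theorem tensor_add_left (u u' : Lp ℝ 2 ν) (v : Lp ℝ 2 ρ) :
    tensor (u + u') v = tensor u v + tensor u' v := by
  apply Lp.ext
  filter_upwards [coeFn_tensor (u + u') v, coeFn_tensor u v, coeFn_tensor u' v,
    Lp.coeFn_add (tensor u v) (tensor u' v), ae_comp_fst (ρ := ρ) (Lp.coeFn_add u u')]
    with p h1 h2 h3 h4 h5
  simp only [Pi.add_apply] at h4 h5
  rw [h1, h4, h2, h3, h5, add_mul]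

theorem tensor_add_right (u : Lp ℝ 2 ν) (v v' : Lp ℝ 2 ρ) :
    tensor u (v + v') = tensor u v + tensor u v' := by
  apply Lp.ext
  filter_upwards [coeFn_tensor u (v + v'), coeFn_tensor u v, coeFn_tensor u v',
    Lp.coeFn_add (tensor u v) (tensor u v'), ae_comp_snd (ν := ν) (Lp.coeFn_add v v')]
    with p h1 h2 h3 h4 h5
  simp only [Pi.add_apply] at h4 h5
  rw [h1, h4, h2, h3, h5, mul_add]

theorem tensor_smul_left (c : ℝ) (u : Lp ℝ 2 ν) (v : Lp ℝ 2 ρ) :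
    tensor (c • u) v = c • tensor u v := by
  apply Lp.ext
  filter_upwards [coeFn_tensor (c • u) v, coeFn_tensor u v,
    Lp.coeFn_smul c (tensor u v), ae_comp_fst (ρ := ρ) (Lp.coeFn_smul c u)]
    with p h1 h2 h3 h4
  simp only [Pi.smul_apply, smul_eq_mul] at h3 h4
  rw [h1, h3, h2, h4, mul_assoc]

theorem tensor_smul_right (c : ℝ) (u : Lp ℝ 2 ν) (v : Lp ℝ 2 ρ) :
    tensor u (c • v) = c • tensor u v := by
  apply Lp.ext
  filter_upwards [coeFn_tensor u (c • v), coeFn_tensor u v,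
    Lp.coeFn_smul c (tensor u v), ae_comp_snd (ν := ν) (Lp.coeFn_smul c v)]
    with p h1 h2 h3 h4
  simp only [Pi.smul_apply, smul_eq_mul] at h3 h4
  rw [h1, h3, h2, h4]
  ring

variable [IsFiniteMeasure ν] [IsFiniteMeasure ρ]

theorem inner_tensor (u u' : Lp ℝ 2 ν) (v v' : Lp ℝ 2 ρ) :
    inner ℝ (tensor u v) (tensor u' v') = inner ℝ u u' * inner ℝ v v' := by
  rw [L2.inner_def, L2.inner_def, L2.inner_def, ← integral_prod_mul]
  refine integral_congr_ae ?_
  filter_upwards [coeFn_tensor u v, coeFn_tensor u' v'] with p h1 h2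
  simp only [h1, h2, RCLike.inner_apply, conj_trivial]
  ring

theorem norm_tensor (u : Lp ℝ 2 ν) (v : Lp ℝ 2 ρ) : ‖tensor u v‖ = ‖u‖ * ‖v‖ := by
  have h := inner_tensor u u v v
  simp only [real_inner_self_eq_norm_sq] at h
  rw [← mul_pow] at h
  exact (sq_eq_sq₀ (norm_nonneg _) (by positivity)).1 h

/-- The tensor product of `L²` functions as a bounded bilinear map. -/
def tensorL : Lp ℝ 2 ν →L[ℝ] Lp ℝ 2 ρ →L[ℝ] Lp ℝ 2 (ν.prod ρ) :=
  LinearMap.mkContinuous₂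
    (LinearMap.mk₂ ℝ tensor tensor_add_left tensor_smul_left tensor_add_right tensor_smul_right)
    1 fun u v => by simp [norm_tensor]

theorem tensorL_apply (u : Lp ℝ 2 ν) (v : Lp ℝ 2 ρ) : tensorL u v = tensor u v := rfl

theorem norm_adjoint_tensorL_le (v : Lp ℝ 2 ρ) (h : Lp ℝ 2 (ν.prod ρ)) :
    ‖((tensorL (ν := ν)).flip v).adjoint h‖ ≤ ‖h‖ * ‖v‖ := by
  have h1 : ‖(tensorL (ν := ν)).flip v‖ ≤ ‖v‖ :=
    ContinuousLinearMap.opNorm_le_bound _ (norm_nonneg _) fun u => by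
      rw [ContinuousLinearMap.flip_apply, tensorL_apply, norm_tensor, mul_comm]
  have h2 := (((tensorL (ν := ν)).flip v).adjoint).le_opNorm h
  rw [LinearIsometryEquiv.norm_map] at h2
  rw [mul_comm]
  exact h2.trans (by gcongr)

theorem inner_adjoint_tensorL (u : Lp ℝ 2 ν) (v : Lp ℝ 2 ρ) (h : Lp ℝ 2 (ν.prod ρ)) :
    inner ℝ u (((tensorL (ν := ν)).flip v).adjoint h) = inner ℝ (tensor u v) h := by
  rw [ContinuousLinearMap.adjoint_inner_right]
  rfl

/-- The integral operator `L²(ρ) → L²(ν)` with kernel `h ∈ L²(ν ⊗ ρ)`, depending boundedly and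
linearly on `h`. It is characterised by `⟪u, kernelOp h v⟫ = ⟪u ⊗ v, h⟫`; its value at `v` is
obtained from the adjoint of `u ↦ u ⊗ v`. -/
def kernelOp : Lp ℝ 2 (ν.prod ρ) →L[ℝ] Lp ℝ 2 ρ →L[ℝ] Lp ℝ 2 ν :=
  LinearMap.mkContinuous₂
    (LinearMap.mk₂ ℝ (fun h v => ((tensorL (ν := ν)).flip v).adjoint h)
      (fun _ _ _ => map_add _ _ _) (fun _ _ _ => map_smul _ _ _)
      (fun h v v' => ext_inner_left ℝ fun u => by
        rw [inner_add_right]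
        simp only [inner_adjoint_tensorL, tensor_add_right, inner_add_left])
      (fun c h v => ext_inner_left ℝ fun u => by
        rw [inner_smul_right]
        simp only [inner_adjoint_tensorL, tensor_smul_right, inner_smul_left]
        rfl))
    1 fun h v => by simpa using norm_adjoint_tensorL_le v h

theorem inner_kernelOp (u : Lp ℝ 2 ν) (v : Lp ℝ 2 ρ) (h : Lp ℝ 2 (ν.prod ρ)) :
    inner ℝ u (kernelOp h v) = inner ℝ (tensor u v) h :=
  inner_adjoint_tensorL u v h

theorem kernelOp_tensor (u : Lp ℝ 2 ν) (v w : Lp ℝ 2 ρ) :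
    kernelOp (tensor u v) w = (inner ℝ v w : ℝ) • u :=
  ext_inner_left ℝ fun u' => by
    rw [inner_kernelOp, inner_tensor, inner_smul_right, real_inner_comm v w, mul_comm]

theorem integrable_mul_snd {F : X × Y → ℝ} (hF : MemLp F 2 (ν.prod ρ)) {v : Y → ℝ}
    (hv : MemLp v 2 ρ) : Integrable (fun p : X × Y => F p * v p.2) (ν.prod ρ) :=
  hF.integrable_mul (hv.comp_snd ν)

/-- The operator `kernelOp` is integration against the kernel; both sides are compared by
integrating over measurable sets. -/
theorem kernelOp_toLp {F : X × Y → ℝ} (hF : MemLp F 2 (ν.prod ρ)) (v : Lp ℝ 2 ρ) :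
    kernelOp (hF.toLp F) v =ᵐ[ν] fun x => ∫ y, F (x, y) * v y ∂ρ := by
  have hI := integrable_mul_snd hF (Lp.memLp v)
  have h1 : Integrable (kernelOp (hF.toLp F) v) ν := (Lp.memLp _).integrable (by norm_num)
  refine h1.ae_eq_of_forall_setIntegral_eq _ _ hI.integral_prod_left fun s hs _ => ?_
  rw [← L2.inner_indicatorConstLp_one hs (measure_ne_top ν s), inner_kernelOp, L2.inner_def]
  have h2 : ∫ p, inner ℝ (tensor (indicatorConstLp 2 hs (measure_ne_top ν s) (1 : ℝ)) v p)
      (hF.toLp F p) ∂(ν.prod ρ) = ∫ p in s ×ˢ univ, F p * v p.2 ∂(ν.prod ρ) := by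
    rw [← integral_indicator (hs.prod MeasurableSet.univ)]
    refine integral_congr_ae ?_
    filter_upwards [coeFn_tensor (indicatorConstLp 2 hs (measure_ne_top ν s) (1 : ℝ)) v,
      hF.coeFn_toLp, ae_comp_fst (ρ := ρ)
        (indicatorConstLp_coeFn (p := 2) (hs := hs) (hμs := measure_ne_top ν s) (c := (1 : ℝ)))]
      with p e1 e2 e3
    simp only [RCLike.inner_apply, conj_trivial]
    rw [e1, e2, e3]
    by_cases hp : p.1 ∈ s
    · simp [hp]
    · simp [hp]
  rw [h2, setIntegral_prod _ hI.integrableOn]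
  simp

theorem ae_memLp_section {F : X × Y → ℝ} (hF : MemLp F 2 (ν.prod ρ)) :
    ∀ᵐ x ∂ν, MemLp (fun y => F (x, y)) 2 ρ := by
  filter_upwards [hF.1.prodMk_left, hF.integrable_sq.prod_right_ae] with x h1 h2
  exact (memLp_two_iff_integrable_sq h1).2 h2

/-- A kernel is determined by its integral operator: testing against a dense sequence shows that
almost every section of a kernel with zero operator vanishes. -/
theorem eq_zero_of_kernelOp_eq_zero [MeasurableSpace.CountablyGenerated Y]
    (h : Lp ℝ 2 (ν.prod ρ)) (h0 : kernelOp h = 0) : h = 0 := by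
  have : Fact ((2 : ENNReal) ≠ ⊤) := ⟨by norm_num⟩
  let d := TopologicalSpace.denseSeq (Lp ℝ 2 ρ)
  have h1 : ∀ n, ∀ᵐ x ∂ν, ∫ y, h (x, y) * d n y ∂ρ = 0 := fun n => by
    have e1 := kernelOp_toLp (Lp.memLp h) (d n)
    rw [Lp.toLp_coeFn, h0] at e1
    filter_upwards [e1, Lp.coeFn_zero ℝ 2 ν] with x hx hx0
    rw [← hx]
    exact hx0
  have h2 : ∀ᵐ x ∂ν, ∫ y, h (x, y) ^ 2 ∂ρ = 0 := by
    filter_upwards [ae_all_iff.2 h1, ae_memLp_section (Lp.memLp h)] with x hx hm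
    have e1 : ∀ w : Lp ℝ 2 ρ, inner ℝ (hm.toLp _) w = ∫ y, h (x, y) * w y ∂ρ := fun w => by
      rw [L2.inner_def]
      refine integral_congr_ae ?_
      filter_upwards [hm.coeFn_toLp] with y hy
      simp only [RCLike.inner_apply, conj_trivial]
      rw [hy, mul_comm]
    have e2 : (fun w => inner ℝ (hm.toLp _) w) = fun _ : Lp ℝ 2 ρ => (0 : ℝ) := by
      refine Continuous.ext_on (TopologicalSpace.denseRange_denseSeq (Lp ℝ 2 ρ))
        (by fun_prop) continuous_const ?_
      rintro _ ⟨n, rfl⟩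
      exact (e1 _).trans (hx n)
    have e3 := congrFun e2 (hm.toLp _)
    simp only [e1] at e3
    rw [← e3]
    refine integral_congr_ae ?_
    filter_upwards [hm.coeFn_toLp] with y hy
    rw [hy, sq]
  rw [← inner_self_eq_zero (𝕜 := ℝ), L2.inner_def]
  have h3 : ∫ p, inner ℝ (h p) (h p) ∂(ν.prod ρ) = ∫ p, h p ^ 2 ∂(ν.prod ρ) := by
    simp [sq]
  rw [h3, integral_prod _ (Lp.memLp h).integrable_sq, integral_congr_ae h2]
  simp

theorem isCompactOperator_kernelOp [MeasurableSpace.CountablyGenerated Y]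
    (h : Lp ℝ 2 (ν.prod ρ)) : IsCompactOperator (kernelOp h) := by
  let W : Submodule ℝ (Lp ℝ 2 (ν.prod ρ)) :=
    Submodule.span ℝ (Set.range fun q : Lp ℝ 2 ν × Lp ℝ 2 ρ => tensor q.1 q.2)
  have hW : W.topologicalClosure = ⊤ := by
    rw [Submodule.topologicalClosure_eq_top_iff, Submodule.eq_bot_iff]
    intro g hg
    refine eq_zero_of_kernelOp_eq_zero g ?_
    ext1 v
    refine ext_inner_left ℝ fun u => ?_
    rw [inner_kernelOp]
    simpa using (Submodule.mem_orthogonal _ _).1 hg _ (Submodule.subset_span ⟨(u, v), rfl⟩)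
  let C : Submodule ℝ (Lp ℝ 2 (ν.prod ρ)) :=
    (compactOperator (RingHom.id ℝ) (Lp ℝ 2 ρ) (Lp ℝ 2 ν)).comap
      (kernelOp (ν := ν) (ρ := ρ)).toLinearMap
  have hC : IsClosed (C : Set (Lp ℝ 2 (ν.prod ρ))) :=
    isClosed_setOfPred_isCompactOperator.preimage kernelOp.continuous
  have hWC : W ≤ C := by
    refine Submodule.span_le.2 ?_
    rintro _ ⟨⟨u, v⟩, rfl⟩
    change IsCompactOperator (kernelOp (tensor u v))
    have : kernelOp (tensor u v) =
        (ContinuousLinearMap.toSpanSingleton ℝ u).comp (innerSL ℝ v) := by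
      ext1 w
      rw [kernelOp_tensor]
      simp
    rw [this]
    exact (isCompactOperator_of_locallyCompactSpace_dom (innerSL ℝ v)).clm_comp
      (ContinuousLinearMap.toSpanSingleton ℝ u)
  have : h ∈ C := Submodule.topologicalClosure_minimal W hWC hC (hW ▸ Submodule.mem_top)
  exact this

/-- A kernel whose integral operator is diagonal with respect to orthonormal families `e`, `f`,
and vanishes on the orthogonal complement of `f`, is the sum of its expansion in `L²(ν ⊗ ρ)`. -/
theorem hasSum_tensor_of_kernelOp [MeasurableSpace.CountablyGenerated Y] {ι : Type*}
    {e : ι → Lp ℝ 2 ν} {f : ι → Lp ℝ 2 ρ} (he : Orthonormal ℝ e) (hf : Orthonormal ℝ f)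
    (c : ι → ℝ) (h : Lp ℝ 2 (ν.prod ρ)) (hc : ∀ i, kernelOp h (f i) = c i • e i)
    (h0 : ∀ w, (∀ i, inner ℝ (f i) w = 0) → kernelOp h w = 0) :
    HasSum (fun i => c i • tensor (e i) (f i)) h := by
  classical
  have ht : Orthonormal ℝ fun i => tensor (e i) (f i) := by
    rw [orthonormal_iff_ite] at he hf ⊢
    intro i j
    rw [inner_tensor, he, hf]
    split_ifs <;> simp
  have hin : ∀ i, inner ℝ (tensor (e i) (f i)) h = c i := fun i => by
    rw [← inner_kernelOp, hc, inner_smul_right, real_inner_self_eq_norm_sq, he.1]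
    simp
  obtain ⟨g, hg, -⟩ := exists_hasSum_inner_smul ht h
  simp only [hin] at hg
  have hgw : ∀ w, HasSum (fun i => (c i * inner ℝ (f i) w) • e i) (kernelOp g w) := fun w => by
    have h1 := ((kernelOp (ν := ν) (ρ := ρ)).flip w).hasSum hg
    convert! h1 using 2 with i
    simp [kernelOp_tensor, mul_smul]
  have hgf : ∀ i, kernelOp g (f i) = c i • e i := fun i => by
    refine (hgw (f i)).unique ?_
    convert! hasSum_ite_eq i (c i • e i) using 2 with j
    rw [orthonormal_iff_ite.1 hf]
    by_cases hj : j = i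
    · subst hj; simp
    · simp [hj]
  have hg0 : ∀ w, (∀ i, inner ℝ (f i) w = 0) → kernelOp g w = 0 := fun w hw => by
    refine (hgw w).unique ?_
    simp [hw, hasSum_zero]
  have hker : kernelOp (h - g) = 0 := by
    let L := (kernelOp (h - g)).ker
    let K : Submodule ℝ (Lp ℝ 2 ρ) := (Submodule.span ℝ (Set.range f)).topologicalClosure
    have hK : K ≤ L := by
      refine Submodule.topologicalClosure_minimal _ (Submodule.span_le.2 ?_)
        (kernelOp (h - g)).isClosed_ker
      rintro _ ⟨i, rfl⟩
      simp [L, map_sub, hc, hgf]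
    have hK' : Kᗮ ≤ L := fun w hw => by
      have hw' : ∀ i, inner ℝ (f i) w = 0 := fun i =>
        (Submodule.mem_orthogonal _ _).1 hw _
          (Submodule.le_topologicalClosure _ (Submodule.subset_span ⟨i, rfl⟩))
      simp [L, map_sub, h0 w hw', hg0 w hw']
    have : CompleteSpace K := (Submodule.isClosed_topologicalClosure _).completeSpace_coe
    have htop : L = ⊤ := by
      rw [eq_top_iff, ← Submodule.sup_orthogonal_of_hasOrthogonalProjection (K := K)]
      exact sup_le hK hK'
    ext1 w
    have : w ∈ L := htop ▸ Submodule.mem_top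
    exact this
  rw [sub_eq_zero.1 (eq_zero_of_kernelOp_eq_zero _ hker)]
  exact hg

end Tensor

/-! ### Singular systems of square-integrable kernels -/

section SingularSystem

variable {X Y : Type*} [MeasurableSpace X] [MeasurableSpace Y]
  {ν : Measure X} {ρ : Measure Y} {ι : Type*}

/-- A singular system of the kernel `F`: orthonormal families `u` in `L²(ν)` and `v` in `L²(ρ)`
and positive singular values `σ` such that integration against `F` maps `v i` to `σ i • u i` and
`u i` to `σ i • v i`, and annihilates the orthogonal complements of the two families. The notion is
symmetric in the two variables. -/
structure IsSingularSystem (ν : Measure X) (ρ : Measure Y) (F : X → Y → ℝ) (σ : ι → ℝ)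
    (u : ι → Lp ℝ 2 ν) (v : ι → Lp ℝ 2 ρ) : Prop where
  pos : ∀ i, 0 < σ i
  orthonormal_left : Orthonormal ℝ u
  orthonormal_right : Orthonormal ℝ v
  integral_right : ∀ i, ∀ᵐ x ∂ν, ∫ y, F x y * v i y ∂ρ = σ i * u i x
  integral_left : ∀ i, ∀ᵐ y ∂ρ, ∫ x, F x y * u i x ∂ν = σ i * v i y
  ker_right : ∀ w : Lp ℝ 2 ρ, (∀ i, inner ℝ (v i) w = 0) → ∀ᵐ x ∂ν, ∫ y, F x y * w y ∂ρ = 0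
  ker_left : ∀ w : Lp ℝ 2 ν, (∀ i, inner ℝ (u i) w = 0) → ∀ᵐ y ∂ρ, ∫ x, F x y * w x ∂ν = 0

theorem IsSingularSystem.symm {F : X → Y → ℝ} {σ : ι → ℝ} {u : ι → Lp ℝ 2 ν}
    {v : ι → Lp ℝ 2 ρ} (h : IsSingularSystem ν ρ F σ u v) :
    IsSingularSystem ρ ν (fun y x => F x y) σ v u :=
  ⟨h.pos, h.orthonormal_right, h.orthonormal_left, h.integral_left, h.integral_right,
    h.ker_left, h.ker_right⟩

/-- Convergence of a series in `L²`, read off on representatives: `Φ` and `f k` represent the sum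
and the terms. -/
theorem tendsto_eLpNorm_sub_partialSum {N : ℕ∞} {f : ℕ → X → ℝ} {Φ : X → ℝ}
    {G : ℕ → Lp ℝ 2 ν} {g : Lp ℝ 2 ν} (hg : g =ᵐ[ν] Φ)
    (hf : ∀ k : ℕ, (k : ℕ∞) < N → G k =ᵐ[ν] f k)
    (hsum : HasSum (fun i : {k : ℕ // (k : ℕ∞) < N} => G i) g) :
    Tendsto (fun n => eLpNorm (fun x => Φ x -
      ∑ k ∈ (Finset.range n).filter (fun k : ℕ => (k : ℕ∞) < N), f k x) 2 ν) atTop (𝓝 0) := by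
  classical
  let S : Set ℕ := {k | (k : ℕ∞) < N}
  have h1 : HasSum (S.indicator G) g := hasSum_subtype_iff_indicator.1 hsum
  have h2 : Tendsto (fun n => ∑ k ∈ (Finset.range n).filter (fun k : ℕ => (k : ℕ∞) < N), G k)
      atTop (𝓝 g) := by
    convert! h1.tendsto_sum_nat using 2 with n
    rw [Finset.sum_filter]
    refine Finset.sum_congr rfl fun k _ => ?_
    by_cases hk : (k : ℕ∞) < N <;> simp [S, hk]
  have h3 : Tendsto (fun n => ‖g -
      ∑ k ∈ (Finset.range n).filter (fun k : ℕ => (k : ℕ∞) < N), G k‖ₑ) atTop (𝓝 0) := by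
    have := (tendsto_const_nhds (x := g)).sub h2
    rw [sub_self] at this
    simpa using this.enorm
  convert! h3 using 2 with n
  rw [Lp.enorm_def]
  refine eLpNorm_congr_ae ?_
  have h4 : ∀ s : Finset ℕ, (∀ k ∈ s, (k : ℕ∞) < N) →
      (↑(∑ k ∈ s, G k) : X → ℝ) =ᵐ[ν] fun x => ∑ k ∈ s, f k x := fun s => by
    induction s using Finset.induction_on with
    | empty =>
      intro _
      filter_upwards [Lp.coeFn_zero ℝ 2 ν] with x hx
      simpa using hx
    | insert a s ha ih =>
      intro hs
      filter_upwards [ih fun k hk => hs k (Finset.mem_insert_of_mem hk),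
        hf a (hs a (Finset.mem_insert_self _ _)), Lp.coeFn_add (G a) (∑ k ∈ s, G k)]
        with x e1 e2 e3
      rw [Finset.sum_insert ha, Finset.sum_insert ha, e3, Pi.add_apply, e1, e2]
  filter_upwards [hg, h4 _ fun k hk => (Finset.mem_filter.1 hk).2,
    Lp.coeFn_sub g (∑ k ∈ (Finset.range n).filter (fun k : ℕ => (k : ℕ∞) < N), G k)]
    with x e1 e2 e3
  rw [e3, Pi.sub_apply, e1, e2]

theorem integrable_gram_mul {F : X → Y → ℝ}
    (hF : MemLp (fun p : X × Y => F p.1 p.2) 2 (ν.prod ρ)) {w : X → ℝ} (hw : MemLp w 2 ν)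
    {f : Y → ℝ} (hf : MemLp f 2 ρ) :
    Integrable (fun p : X × Y => f p.2 * F p.1 p.2 * w p.1) (ν.prod ρ) := by
  have := hF.integrable_mul (memLp_tensor hw hf)
  refine this.congr (ae_of_all _ fun p => ?_)
  simp only [Pi.mul_apply]
  ring

variable [IsFiniteMeasure ν] [IsFiniteMeasure ρ]

theorem memLp_swap {F : X → Y → ℝ} (hF : MemLp (fun p : X × Y => F p.1 p.2) 2 (ν.prod ρ)) :
    MemLp (fun p : Y × X => F p.2 p.1) 2 (ρ.prod ν) :=
  hF.comp_measurePreserving Measure.measurePreserving_swap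

/-- The transposed kernel has the adjoint operator. -/
theorem kernelOp_swap {F : X → Y → ℝ} (hF : MemLp (fun p : X × Y => F p.1 p.2) 2 (ν.prod ρ)) :
    kernelOp ((memLp_swap hF).toLp _) = (kernelOp (hF.toLp _)).adjoint := by
  ext1 u
  refine ext_inner_left ℝ fun v => ?_
  rw [inner_kernelOp, ContinuousLinearMap.adjoint_inner_right, real_inner_comm u, inner_kernelOp,
    L2.inner_def, L2.inner_def]
  rw [← (Measure.measurePreserving_swap (μ := ν) (ν := ρ)).integral_comp
    MeasurableEquiv.prodComm.measurableEmbedding]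
  refine integral_congr_ae ?_
  have hq := (Measure.measurePreserving_swap (μ := ν) (ν := ρ)).quasiMeasurePreserving
  filter_upwards [hF.coeFn_toLp, hq.ae_eq_comp (memLp_swap hF).coeFn_toLp, coeFn_tensor u v,
    hq.ae_eq_comp (coeFn_tensor v u)] with p h1 h2 h3 h4
  simp only [Function.comp_apply, Prod.fst_swap, Prod.snd_swap] at h2 h4
  simp only [RCLike.inner_apply, conj_trivial]
  rw [h1, h2, h3, h4, mul_comm (v p.2)]

/-- Every square-integrable kernel has a singular system, whose singular values can be
listed in non-increasing order. -/
theorem exists_isSingularSystem [MeasurableSpace.CountablyGenerated Y] {F : X → Y → ℝ}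
    (hF : MemLp (fun p : X × Y => F p.1 p.2) 2 (ν.prod ρ)) :
    ∃ (N : ℕ∞) (σ : ℕ → ℝ) (u : ℕ → Lp ℝ 2 ν) (v : ℕ → Lp ℝ 2 ρ),
      (∀ k, 0 ≤ σ k) ∧ (∀ j k : ℕ, j ≤ k → (k : ℕ∞) < N → σ k ≤ σ j) ∧
      IsSingularSystem ν ρ F (fun i : {k : ℕ // (k : ℕ∞) < N} => σ i) (fun i => u i)
        (fun i => v i) := by
  classical
  set h := hF.toLp _ with hh
  let A := kernelOp h
  obtain ⟨κ, l, v, hv, hl, hAv, hA0⟩ :=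
    exists_orthonormal_eigenvectors A (isCompactOperator_kernelOp h)
  let u : κ → Lp ℝ 2 ν := fun i => (Real.sqrt (l i))⁻¹ • A (v i)
  have hs : ∀ i, 0 < Real.sqrt (l i) := fun i => Real.sqrt_pos.2 (hl i)
  have hAu : ∀ i, A (v i) = Real.sqrt (l i) • u i := fun i => by
    simp only [u]
    rw [smul_inv_smul₀ (hs i).ne']
  have hAu' : ∀ i, A.adjoint (u i) = Real.sqrt (l i) • v i := fun i => by
    simp only [u]
    rw [map_smul, hAv, smul_smul]
    congr 1
    rw [inv_mul_eq_div, Real.div_sqrt]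
  have hu : Orthonormal ℝ u := by
    rw [orthonormal_iff_ite] at hv ⊢
    intro i j
    simp only [u]
    rw [inner_smul_left, inner_smul_right, ← ContinuousLinearMap.adjoint_inner_left, hAv,
      inner_smul_left, hv]
    by_cases hij : i = j
    · subst hij
      have := hs i
      have h2 : l i = Real.sqrt (l i) * Real.sqrt (l i) := (Real.mul_self_sqrt (hl i).le).symm
      simp only [if_true, mul_one, conj_trivial]
      field_simp
      rw [sq]
      exact h2
    · simp [hij]
  have ht : Orthonormal ℝ fun i => tensor (u i) (v i) := by
    rw [orthonormal_iff_ite] at hu hv ⊢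
    intro i j
    rw [inner_tensor, hu, hv]
    split_ifs <;> simp
  -- Bessel's inequality for the family `u i ⊗ v i` makes the eigenvalues summable.
  have hsum : Summable l := by
    convert! ht.inner_products_summable h using 2 with i
    have : inner ℝ (tensor (u i) (v i)) h = Real.sqrt (l i) := by
      rw [← inner_kernelOp]
      change inner ℝ (u i) (A (v i)) = _
      rw [hAu, inner_smul_right, real_inner_self_eq_norm_sq, hu.1]
      simp
    rw [this, Real.norm_eq_abs, sq_abs, Real.sq_sqrt (hl i).le]
  have hfin : ∀ ε : ℝ, 0 < ε → {i | ε ≤ l i}.Finite := fun ε hε => by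
    have := hsum.tendsto_cofinite_zero.eventually (gt_mem_nhds hε)
    simpa [Filter.eventually_cofinite] using this
  obtain ⟨N, e, he⟩ := exists_antitone_enumeration l hl hfin
  refine ⟨N, fun k => if hk : (k : ℕ∞) < N then Real.sqrt (l (e ⟨k, hk⟩)) else 0,
    fun k => if hk : (k : ℕ∞) < N then u (e ⟨k, hk⟩) else 0,
    fun k => if hk : (k : ℕ∞) < N then v (e ⟨k, hk⟩) else 0, ?_, ?_, ?_⟩
  · intro k
    dsimp only
    split_ifs
    exacts [Real.sqrt_nonneg _, le_rfl]
  · intro j k hjk hk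
    have hj : (j : ℕ∞) < N := lt_of_le_of_lt (by exact_mod_cast hjk) hk
    simp only [hj, hk, dif_pos]
    exact Real.sqrt_le_sqrt (he ⟨j, hj⟩ ⟨k, hk⟩ hjk)
  · have hA : ∀ w, ∀ᵐ x ∂ν, A w x = ∫ y, F x y * w y ∂ρ := fun w => kernelOp_toLp hF w
    have hA' : ∀ w, ∀ᵐ y ∂ρ, A.adjoint w y = ∫ x, F x y * w x ∂ν := fun w => by
      have := kernelOp_toLp (memLp_swap hF) w
      rw [kernelOp_swap] at this
      exact this
    have hsys : IsSingularSystem ν ρ F (fun i => Real.sqrt (l (e i))) (fun i => u (e i))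
        (fun i => v (e i)) := by
      refine ⟨fun i => hs _, hu.comp _ e.injective, hv.comp _ e.injective, fun i => ?_,
        fun i => ?_, fun w hw => ?_, fun w hw => ?_⟩
      · filter_upwards [hA (v (e i)), Lp.coeFn_smul (Real.sqrt (l (e i))) (u (e i))] with x h1 h2
        rw [← h1, hAu, h2]
        rfl
      · filter_upwards [hA' (u (e i)), Lp.coeFn_smul (Real.sqrt (l (e i))) (v (e i))] with x h1 h2
        rw [← h1, hAu', h2]
        rfl
      · have h0 : A w = 0 := hA0 w fun i => by simpa using hw (e.symm i)
        filter_upwards [hA w, Lp.coeFn_zero ℝ 2 ν] with x h1 h2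
        rw [← h1, h0, h2]
        rfl
      · have h0 : A (A.adjoint w) = 0 := hA0 _ fun i => by
          rw [ContinuousLinearMap.adjoint_inner_right, hAu, inner_smul_left]
          have : inner ℝ (u i) w = 0 := by simpa using hw (e.symm i)
          rw [this, mul_zero]
        have h1 : A.adjoint w = 0 := by
          rw [← inner_self_eq_zero (𝕜 := ℝ), ContinuousLinearMap.adjoint_inner_left, h0,
            inner_zero_right]
        filter_upwards [hA' w, Lp.coeFn_zero ℝ 2 ρ] with x h2 h3
        rw [← h2, h1, h3]
        rfl
    convert! hsys using 2 with i i i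
    all_goals simp [i.2]

/-- The kernel `(x, x') ↦ ∫ F x y * F x' y dy` acts as integration against `F` in the first
variable followed by integration against `F` in the second. -/
theorem ae_integral_gram_mul {F : X → Y → ℝ}
    (hF : MemLp (fun p : X × Y => F p.1 p.2) 2 (ν.prod ρ)) {w : X → ℝ} (hw : MemLp w 2 ν) :
    ∀ᵐ x ∂ν, Integrable (fun x' => (∫ y, F x y * F x' y ∂ρ) * w x') ν ∧
      ∫ x', (∫ y, F x y * F x' y ∂ρ) * w x' ∂ν = ∫ y, F x y * ∫ x', F x' y * w x' ∂ν ∂ρ := by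
  filter_upwards [ae_memLp_section hF] with x hx
  have hI := integrable_gram_mul hF hw hx
  have e1 : ∀ x', (∫ y, F x y * F x' y ∂ρ) * w x' = ∫ y, F x y * F x' y * w x' ∂ρ := fun x' =>
    (integral_mul_const _ _).symm
  simp only [e1]
  refine ⟨hI.integral_prod_left, ?_⟩
  rw [integral_integral_swap hI]
  refine integral_congr_ae (ae_of_all _ fun y => ?_)
  simp only [mul_assoc]
  exact integral_const_mul _ _

/-- Square-integrability follows from the Cauchy–Schwarz bound by `√(M x) * √(M x')`, where
`M x = ∫ F x y ^ 2 dy` is integrable. -/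
theorem memLp_gram {F : X → Y → ℝ} (hF : MemLp (fun p : X × Y => F p.1 p.2) 2 (ν.prod ρ)) :
    MemLp (fun p : X × X => ∫ y, F p.1 y * F p.2 y ∂ρ) 2 (ν.prod ν) := by
  have hmeas : AEStronglyMeasurable (fun p : X × X => ∫ y, F p.1 y * F p.2 y ∂ρ) (ν.prod ν) := by
    have h1 : Measure.QuasiMeasurePreserving (Prod.map Prod.fst id : (X × X) × Y → X × Y)
        ((ν.prod ν).prod ρ) (ν.prod ρ) :=
      QuasiMeasurePreserving.prodMap Measure.quasiMeasurePreserving_fst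
        (Measure.QuasiMeasurePreserving.id ρ)
    have h2 : Measure.QuasiMeasurePreserving (Prod.map Prod.snd id : (X × X) × Y → X × Y)
        ((ν.prod ν).prod ρ) (ν.prod ρ) :=
      QuasiMeasurePreserving.prodMap Measure.quasiMeasurePreserving_snd
        (Measure.QuasiMeasurePreserving.id ρ)
    exact ((hF.1.comp_quasiMeasurePreserving h1).mul
      (hF.1.comp_quasiMeasurePreserving h2)).integral_prod_right'
  let M : X → ℝ := fun x => ∫ y, F x y ^ 2 ∂ρ
  have hM0 : ∀ x, 0 ≤ M x := fun x => integral_nonneg fun y => sq_nonneg _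
  have hM : Integrable M ν := hF.integrable_sq.integral_prod_left
  have hS : MemLp (fun x => Real.sqrt (M x)) 2 ν := by
    refine (memLp_two_iff_integrable_sq
      (Real.continuous_sqrt.comp_aestronglyMeasurable hM.1)).2 ?_
    refine hM.congr (ae_of_all _ fun x => (Real.sq_sqrt (hM0 x)).symm)
  refine (memLp_tensor hS hS).mono hmeas ?_
  have hsec := ae_memLp_section hF
  filter_upwards [Measure.quasiMeasurePreserving_fst.ae hsec,
    Measure.quasiMeasurePreserving_snd.ae hsec] with p h1 h2
  rw [Real.norm_eq_abs, Real.norm_of_nonneg (by positivity)]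
  have hin : ∀ {f g : Y → ℝ} (hf : MemLp f 2 ρ) (hg : MemLp g 2 ρ),
      inner ℝ (hf.toLp f) (hg.toLp g) = ∫ y, f y * g y ∂ρ := fun hf hg => by
    rw [L2.inner_def]
    refine integral_congr_ae ?_
    filter_upwards [hf.coeFn_toLp, hg.coeFn_toLp] with y e1 e2
    simp only [RCLike.inner_apply, conj_trivial]
    rw [e1, e2, mul_comm]
  have hnorm : ∀ {f : Y → ℝ} (hf : MemLp f 2 ρ),
      ‖hf.toLp f‖ = Real.sqrt (∫ y, f y ^ 2 ∂ρ) := fun hf => by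
    rw [← Real.sqrt_sq (norm_nonneg (hf.toLp _)), ← real_inner_self_eq_norm_sq, hin hf hf]
    simp only [sq]
  rw [← hin h1 h2, ← hnorm h1, ← hnorm h2]
  exact abs_real_inner_le_norm _ _

section System

variable {F : X → Y → ℝ} {σ : ι → ℝ} {u : ι → Lp ℝ 2 ν} {v : ι → Lp ℝ 2 ρ}

theorem IsSingularSystem.hasSum [MeasurableSpace.CountablyGenerated Y]
    (h : IsSingularSystem ν ρ F σ u v)
    (hF : MemLp (fun p : X × Y => F p.1 p.2) 2 (ν.prod ρ)) :
    HasSum (fun i => σ i • tensor (u i) (v i)) (hF.toLp _) := by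
  refine hasSum_tensor_of_kernelOp h.orthonormal_left h.orthonormal_right σ _ (fun i => ?_)
    fun w hw => ?_
  · apply Lp.ext
    filter_upwards [kernelOp_toLp hF (v i), h.integral_right i, Lp.coeFn_smul (σ i) (u i)]
      with x h1 h2 h3
    rw [h1, h2, h3]
    rfl
  · apply Lp.ext
    filter_upwards [kernelOp_toLp hF w, h.ker_right w hw, Lp.coeFn_zero ℝ 2 ν] with x h1 h2 h3
    rw [h1, h2, h3]
    rfl

/-- The left singular functions are eigenfunctions of `(x, x') ↦ ∫ F x y * F x' y dy`. -/
theorem IsSingularSystem.ae_integral_gram_mul (h : IsSingularSystem ν ρ F σ u v)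
    (hF : MemLp (fun p : X × Y => F p.1 p.2) 2 (ν.prod ρ)) (i : ι) :
    ∀ᵐ x ∂ν, Integrable (fun x' => (∫ y, F x y * F x' y ∂ρ) * u i x') ν ∧
      ∫ x', (∫ y, F x y * F x' y ∂ρ) * u i x' ∂ν = σ i ^ 2 * u i x := by
  filter_upwards [FSVD.ae_integral_gram_mul hF (Lp.memLp (u i)), h.integral_right i]
    with x h1 h2
  refine ⟨h1.1, ?_⟩
  have h3 : ∫ y, F x y * ∫ x', F x' y * u i x' ∂ν ∂ρ = ∫ y, σ i * (F x y * v i y) ∂ρ := by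
    refine integral_congr_ae ?_
    filter_upwards [h.integral_left i] with y hy
    rw [hy]
    ring
  rw [h1.2, h3, integral_const_mul, h2]
  ring

theorem IsSingularSystem.hasSum_gram [MeasurableSpace.CountablyGenerated X]
    (h : IsSingularSystem ν ρ F σ u v)
    (hF : MemLp (fun p : X × Y => F p.1 p.2) 2 (ν.prod ρ)) :
    HasSum (fun i => σ i ^ 2 • tensor (u i) (u i)) ((memLp_gram hF).toLp _) := by
  refine hasSum_tensor_of_kernelOp h.orthonormal_left h.orthonormal_left _ _ (fun i => ?_)
    fun w hw => ?_
  · apply Lp.ext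
    filter_upwards [kernelOp_toLp (memLp_gram hF) (u i), h.ae_integral_gram_mul hF i,
      Lp.coeFn_smul (σ i ^ 2) (u i)] with x h1 h2 h3
    rw [h1, h2.2, h3]
    rfl
  · apply Lp.ext
    filter_upwards [kernelOp_toLp (memLp_gram hF) w,
      FSVD.ae_integral_gram_mul hF (Lp.memLp w), Lp.coeFn_zero ℝ 2 ν] with x h1 h2 h3
    rw [h1, h2.2, h3]
    have h4 : ∫ y, F x y * ∫ x', F x' y * w x' ∂ν ∂ρ = ∫ y, (0 : ℝ) ∂ρ := by
      refine integral_congr_ae ?_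
      filter_upwards [h.ker_left w hw] with y hy
      rw [hy, mul_zero]
    rw [h4]
    simp

end System

end SingularSystem

/-! ### Singular functions and the expansions in `L²` -/

/-- The representative `x ↦ (σ k)⁻¹ ∫ F x y * v k y dy` of the `k`-th left singular function. It is
chosen because it inherits continuity from `F`, and because the identity
`σ k * singularFn ρ F σ v k x = ∫ F x y * v k y dy` then holds at every point. -/
def singularFn {X Y : Type*} [MeasurableSpace Y] (ρ : Measure Y) (F : X → Y → ℝ) (σ : ℕ → ℝ)
    (v : ℕ → Lp ℝ 2 ρ) (k : ℕ) (x : X) : ℝ :=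
  (σ k)⁻¹ * ∫ y, F x y * v k y ∂ρ

section SingularFunctions

variable {X Y : Type*} [MeasurableSpace X] [MeasurableSpace Y]
  {ν : Measure X} {ρ : Measure Y} {N : ℕ∞} {F : X → Y → ℝ} {σ : ℕ → ℝ} {u : ℕ → Lp ℝ 2 ν}
  {v : ℕ → Lp ℝ 2 ρ}

theorem ae_eq_singularFn
    (h : IsSingularSystem ν ρ F (fun i : {k : ℕ // (k : ℕ∞) < N} => σ i) (fun i => u i)
      (fun i => v i)) {k : ℕ} (hk : (k : ℕ∞) < N) :
    u k =ᵐ[ν] singularFn ρ F σ v k := by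
  have hs : 0 < σ k := h.pos ⟨k, hk⟩
  filter_upwards [h.integral_right ⟨k, hk⟩] with x hx
  rw [singularFn, hx, inv_mul_cancel_left₀ hs.ne']

end SingularFunctions

section RealKernel

variable {S T : Set ℝ} {N : ℕ∞} {F : ℝ → ℝ → ℝ} {σ : ℕ → ℝ}
  {u : ℕ → Lp ℝ 2 (volume.restrict S)} {v : ℕ → Lp ℝ 2 (volume.restrict T)}

theorem isOrthonormalSeq_singularFn
    (h : IsSingularSystem (volume.restrict S) (volume.restrict T) F
      (fun i : {k : ℕ // (k : ℕ∞) < N} => σ i) (fun i => u i) (fun i => v i)) :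
    IsOrthonormalSeq N (singularFn (volume.restrict T) F σ v) S := by
  refine ⟨fun k hk => (Lp.memLp (u k)).ae_eq (ae_eq_singularFn h hk), fun j k hj hk => ?_⟩
  have h1 := orthonormal_iff_ite.1 h.orthonormal_left ⟨j, hj⟩ ⟨k, hk⟩
  simp only [Subtype.mk.injEq] at h1
  rw [← h1, L2.inner_def]
  refine integral_congr_ae ?_
  filter_upwards [ae_eq_singularFn h hj, ae_eq_singularFn h hk] with x e1 e2
  simp only [RCLike.inner_apply, conj_trivial]
  rw [e1, e2, mul_comm]

variable [IsFiniteMeasure (volume.restrict S)] [IsFiniteMeasure (volume.restrict T)]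

theorem isEigenfunction_singularFn
    (h : IsSingularSystem (volume.restrict S) (volume.restrict T) F
      (fun i : {k : ℕ // (k : ℕ∞) < N} => σ i) (fun i => u i) (fun i => v i))
    (hF : MemLp (fun p : ℝ × ℝ => F p.1 p.2) 2
      ((volume.restrict S).prod (volume.restrict T))) {k : ℕ} (hk : (k : ℕ∞) < N) :
    IsEigenfunction (kernelOne F T) S (σ k ^ 2) (singularFn (volume.restrict T) F σ v k) := by
  have hae := ae_eq_singularFn h hk
  refine ⟨(Lp.memLp (u k)).ae_eq hae, fun h0 => ?_, ?_⟩
  · have h1 : ‖u k‖ = 1 := h.orthonormal_left.1 ⟨k, hk⟩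
    have h2 : u k = 0 := (Lp.eq_zero_iff_ae_eq_zero).2 (hae.trans h0)
    rw [h2, norm_zero] at h1
    exact zero_ne_one h1
  · filter_upwards [h.ae_integral_gram_mul hF ⟨k, hk⟩, hae] with x h1 h2
    have h3 : (fun y => kernelOne F T x y * u k y) =ᵐ[volume.restrict S]
        fun y => kernelOne F T x y * singularFn (volume.restrict T) F σ v k y := by
      filter_upwards [hae] with y hy
      rw [hy]
    refine ⟨h1.1.congr h3, ?_⟩
    rw [← integral_congr_ae h3, ← h2]
    exact h1.2

theorem seriesConvergesL2_kernelOne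
    (h : IsSingularSystem (volume.restrict S) (volume.restrict T) F
      (fun i : {k : ℕ // (k : ℕ∞) < N} => σ i) (fun i => u i) (fun i => v i))
    (hF : MemLp (fun p : ℝ × ℝ => F p.1 p.2) 2
      ((volume.restrict S).prod (volume.restrict T))) :
    SeriesConvergesL2 N (fun k p => σ k ^ 2 * singularFn (volume.restrict T) F σ v k p.1 *
        singularFn (volume.restrict T) F σ v k p.2)
      (fun p => kernelOne F T p.1 p.2) (S ×ˢ S) := by
  unfold SeriesConvergesL2
  rw [Measure.volume_eq_prod, ← Measure.prod_restrict]
  refine ⟨memLp_gram hF, tendsto_eLpNorm_sub_partialSum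
    (G := fun k => σ k ^ 2 • tensor (u k) (u k)) (memLp_gram hF).coeFn_toLp (fun k hk => ?_)
    (h.hasSum_gram hF)⟩
  filter_upwards [Lp.coeFn_smul (σ k ^ 2) (tensor (u k) (u k)), coeFn_tensor (u k) (u k),
    ae_comp_fst (ρ := volume.restrict S) (ae_eq_singularFn h hk),
    ae_comp_snd (ν := volume.restrict S) (ae_eq_singularFn h hk)] with p h1 h2 h3 h4
  rw [h1, Pi.smul_apply, h2, h3, h4, smul_eq_mul, mul_assoc]

theorem seriesConvergesL2_kernel
    (h : IsSingularSystem (volume.restrict S) (volume.restrict T) F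
      (fun i : {k : ℕ // (k : ℕ∞) < N} => σ i) (fun i => u i) (fun i => v i))
    (hF : MemLp (fun p : ℝ × ℝ => F p.1 p.2) 2
      ((volume.restrict S).prod (volume.restrict T))) :
    SeriesConvergesL2 N (fun k p => σ k * singularFn (volume.restrict T) F σ v k p.1 *
        singularFn (volume.restrict S) (fun y x => F x y) σ u k p.2)
      (fun p => F p.1 p.2) (S ×ˢ T) := by
  unfold SeriesConvergesL2
  rw [Measure.volume_eq_prod, ← Measure.prod_restrict]
  refine ⟨hF, tendsto_eLpNorm_sub_partialSum
    (G := fun k => σ k • tensor (u k) (v k)) hF.coeFn_toLp (fun k hk => ?_) (h.hasSum hF)⟩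
  filter_upwards [Lp.coeFn_smul (σ k) (tensor (u k) (v k)), coeFn_tensor (u k) (v k),
    ae_comp_fst (ρ := volume.restrict T) (ae_eq_singularFn h hk),
    ae_comp_snd (ν := volume.restrict S) (ae_eq_singularFn h.symm hk)] with p h1 h2 h3 h4
  rw [h1, Pi.smul_apply, h2, h3, h4, smul_eq_mul, mul_assoc]

end RealKernel

/-! ### Continuous kernels -/

/-- The uniform part of Mercer's theorem: if `K x x' = ∑ g k x * g k x'` pointwise on a compact set,
with `K` and all `g k` continuous, then Dini's theorem makes the diagonal series converge
uniformly, and its tails control those of the full series, also of absolute values. -/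
theorem tendstoUniformlyOn_sum_mul {X : Type*} [TopologicalSpace X] {S : Set X} (hS : IsCompact S)
    {g : ℕ → X → ℝ} {K : X → X → ℝ} (hg : ∀ k, ContinuousOn (g k) S)
    (hK : ContinuousOn (fun p : X × X => K p.1 p.2) (S ×ˢ S))
    (hsum : ∀ x ∈ S, ∀ x' ∈ S, HasSum (fun k => g k x * g k x') (K x x')) :
    TendstoUniformlyOn (fun n (p : X × X) => ∑ k ∈ Finset.range n, g k p.1 * g k p.2)
      (fun p => K p.1 p.2) atTop (S ×ˢ S) ∧
    ∃ G : X × X → ℝ,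
      TendstoUniformlyOn (fun n (p : X × X) => ∑ k ∈ Finset.range n, |g k p.1 * g k p.2|)
        G atTop (S ×ˢ S) := by
  have hdini : TendstoUniformlyOn (fun n x => ∑ k ∈ Finset.range n, g k x * g k x)
      (fun x => K x x) atTop S := by
    refine Monotone.tendstoUniformlyOn_of_forall_tendsto hS (fun n => ?_) (fun x _ => ?_) ?_
      fun x hx => (hsum x hx x hx).tendsto_sum_nat
    · exact continuousOn_finsetSum _ fun k _ => (hg k).mul (hg k)
    · refine monotone_nat_of_le_succ fun n => ?_
      rw [Finset.sum_range_succ]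
      exact le_add_of_nonneg_right (mul_self_nonneg _)
    · exact hK.comp (continuousOn_id.prodMk continuousOn_id) fun x hx => ⟨hx, hx⟩
  have main : ∀ (t : ℕ → X × X → ℝ) (H : X × X → ℝ),
      (∀ k p, |t k p| ≤ (g k p.1 * g k p.1 + g k p.2 * g k p.2) / 2) →
      (∀ p ∈ S ×ˢ S, HasSum (fun k => t k p) (H p)) →
      TendstoUniformlyOn (fun n p => ∑ k ∈ Finset.range n, t k p) H atTop (S ×ˢ S) := by
    intro t H hle hH
    rw [Metric.tendstoUniformlyOn_iff] at hdini ⊢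
    intro ε hε
    filter_upwards [hdini ε hε] with n hn p hp
    have h1 := (hasSum_nat_add_iff' n).2 (hsum p.1 hp.1 p.1 hp.1)
    have h2 := (hasSum_nat_add_iff' n).2 (hsum p.2 hp.2 p.2 hp.2)
    have h3 := (hasSum_nat_add_iff' n).2 (hH p hp)
    have h4 : |H p - ∑ k ∈ Finset.range n, t k p| ≤
        ((K p.1 p.1 - ∑ k ∈ Finset.range n, g k p.1 * g k p.1) +
          (K p.2 p.2 - ∑ k ∈ Finset.range n, g k p.2 * g k p.2)) / 2 :=
      h3.norm_le_of_bounded ((h1.add h2).div_const 2) fun k => hle _ p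
    have h5 := (abs_lt.1 (hn p.1 hp.1)).2
    have h6 := (abs_lt.1 (hn p.2 hp.2)).2
    rw [Real.dist_eq]
    linarith
  have habs : ∀ a b : ℝ, |a * b| ≤ (a * a + b * b) / 2 := fun a b => by
    rw [abs_le]
    constructor <;> nlinarith [sq_nonneg (a - b), sq_nonneg (a + b)]
  refine ⟨main _ _ (fun k p => habs _ _) fun p hp => hsum _ hp.1 _ hp.2,
    fun p => ∑' k, |g k p.1 * g k p.2|, main _ _ (fun k p => ?_) fun p hp => ?_⟩
  · rw [abs_abs]
    exact habs _ _
  · exact (hsum _ hp.1 _ hp.2).summable.abs.hasSum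

section ContinuousKernel

variable {a b c d : ℝ} {F : ℝ → ℝ → ℝ}

theorem memLp_section
    (hF : ContinuousOn (fun p : ℝ × ℝ => F p.1 p.2) (Icc a b ×ˢ Icc c d)) {x : ℝ}
    (hx : x ∈ Icc a b) : MemLp (F x) 2 (volume.restrict (Icc c d)) := by
  have hc : ContinuousOn (F x) (Icc c d) :=
    hF.comp (f := fun y => (x, y)) (by fun_prop) fun y hy => ⟨hx, hy⟩
  exact (memLp_two_iff_integrable_sq (hc.aestronglyMeasurable measurableSet_Icc)).2
    (hc.pow 2).integrableOn_Icc

theorem exists_abs_le_of_continuousOn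
    (hF : ContinuousOn (fun p : ℝ × ℝ => F p.1 p.2) (Icc a b ×ˢ Icc c d)) :
    ∃ C : ℝ, ∀ x ∈ Icc a b, ∀ y ∈ Icc c d, |F x y| ≤ C := by
  obtain ⟨C, hC⟩ := (isCompact_Icc.prod isCompact_Icc).exists_bound_of_continuousOn hF
  exact ⟨C, fun x hx y hy => hC (x, y) ⟨hx, hy⟩⟩

theorem continuousOn_integral_mul
    (hF : ContinuousOn (fun p : ℝ × ℝ => F p.1 p.2) (Icc a b ×ˢ Icc c d))
    (w : Lp ℝ 2 (volume.restrict (Icc c d))) :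
    ContinuousOn (fun x => ∫ y in Icc c d, F x y * w y) (Icc a b) := by
  obtain ⟨C, hC⟩ := exists_abs_le_of_continuousOn hF
  have hw : Integrable w (volume.restrict (Icc c d)) := (Lp.memLp w).integrable (by norm_num)
  refine continuousOn_of_dominated (bound := fun y => C * |w y|) (fun x hx => ?_) (fun x hx => ?_)
    (hw.abs.const_mul C) ?_
  · exact (memLp_section hF hx).1.mul hw.1
  · filter_upwards [ae_restrict_mem measurableSet_Icc] with y hy
    rw [norm_mul, Real.norm_eq_abs, Real.norm_eq_abs]
    exact mul_le_mul_of_nonneg_right (hC x hx y hy) (abs_nonneg _)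
  · filter_upwards [ae_restrict_mem measurableSet_Icc] with y hy
    exact (hF.comp (f := fun x => (x, y)) (by fun_prop) fun x hx => ⟨hx, hy⟩).mul
      continuousOn_const

theorem continuousOn_kernelOne
    (hF : ContinuousOn (fun p : ℝ × ℝ => F p.1 p.2) (Icc a b ×ˢ Icc c d)) :
    ContinuousOn (fun p : ℝ × ℝ => kernelOne F (Icc c d) p.1 p.2) (Icc a b ×ˢ Icc a b) := by
  obtain ⟨C, hC⟩ := exists_abs_le_of_continuousOn hF
  refine continuousOn_of_dominated (bound := fun _ => C * C) (fun p hp => ?_) (fun p hp => ?_)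
    (integrable_const _) ?_
  · exact (memLp_section hF hp.1).1.mul (memLp_section hF hp.2).1
  · filter_upwards [ae_restrict_mem measurableSet_Icc] with y hy
    rw [norm_mul, Real.norm_eq_abs, Real.norm_eq_abs]
    exact mul_le_mul (hC _ hp.1 y hy) (hC _ hp.2 y hy) (abs_nonneg _)
      ((abs_nonneg _).trans (hC _ hp.1 y hy))
  · filter_upwards [ae_restrict_mem measurableSet_Icc] with y hy
    exact (hF.comp (f := fun p : ℝ × ℝ => (p.1, y)) (by fun_prop) fun p hp => ⟨hp.1, hy⟩).mul
      (hF.comp (f := fun p : ℝ × ℝ => (p.2, y)) (by fun_prop) fun p hp => ⟨hp.2, hy⟩)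

theorem eqOn_Icc_of_ae_eq (hab : a < b) {f g : ℝ → ℝ}
    (h : f =ᵐ[volume.restrict (Icc a b)] g) (hf : ContinuousOn f (Icc a b))
    (hg : ContinuousOn g (Icc a b)) : EqOn f g (Icc a b) :=
  Measure.eqOn_of_ae_eq h hf hg (by rw [interior_Icc, closure_Ioo hab.ne])

theorem inner_toLp_left {f : ℝ → ℝ} (hf : MemLp f 2 (volume.restrict (Icc c d)))
    (w : Lp ℝ 2 (volume.restrict (Icc c d))) :
    inner ℝ (hf.toLp f) w = ∫ y in Icc c d, f y * w y := by
  rw [L2.inner_def]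
  refine integral_congr_ae ?_
  filter_upwards [hf.coeFn_toLp] with y e1
  simp only [RCLike.inner_apply, conj_trivial]
  rw [e1, mul_comm]

variable {N : ℕ∞} {σ : ℕ → ℝ} {u : ℕ → Lp ℝ 2 (volume.restrict (Icc a b))}
  {v : ℕ → Lp ℝ 2 (volume.restrict (Icc c d))}

theorem continuousOn_singularFn
    (hF : ContinuousOn (fun p : ℝ × ℝ => F p.1 p.2) (Icc a b ×ˢ Icc c d)) (k : ℕ) :
    ContinuousOn (singularFn (volume.restrict (Icc c d)) F σ v k) (Icc a b) :=
  continuousOn_const.mul (continuousOn_integral_mul hF (v k))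

/-- For a continuous kernel every section, not only almost every one, is the sum of its expansion
in the right singular functions: for `w` orthogonal to all of them, `x ↦ ∫ F x y * w y dy` is
continuous and vanishes almost everywhere. -/
theorem hasSum_section (hab : a < b)
    (h : IsSingularSystem (volume.restrict (Icc a b)) (volume.restrict (Icc c d)) F
      (fun i : {k : ℕ // (k : ℕ∞) < N} => σ i) (fun i => u i) (fun i => v i))
    (hF : ContinuousOn (fun p : ℝ × ℝ => F p.1 p.2) (Icc a b ×ˢ Icc c d)) {x : ℝ}
    (hx : x ∈ Icc a b) :
    HasSum (fun i : {k : ℕ // (k : ℕ∞) < N} =>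
      (σ i * singularFn (volume.restrict (Icc c d)) F σ v i x) • v i)
      ((memLp_section hF hx).toLp _) := by
  have h1 := hasSum_inner_smul_of_orthogonal h.orthonormal_right ((memLp_section hF hx).toLp _)
    fun w hw => by
      rw [inner_toLp_left]
      exact eqOn_Icc_of_ae_eq hab (h.ker_right w hw) (continuousOn_integral_mul hF w)
        continuousOn_const hx
  convert! h1 using 3 with i
  have hs : 0 < σ i := h.pos i
  rw [real_inner_comm, inner_toLp_left, singularFn, mul_inv_cancel_left₀ hs.ne']

/-- Parseval's identity for two sections of a continuous kernel. -/
theorem hasSum_kernelOne (hab : a < b)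
    (h : IsSingularSystem (volume.restrict (Icc a b)) (volume.restrict (Icc c d)) F
      (fun i : {k : ℕ // (k : ℕ∞) < N} => σ i) (fun i => u i) (fun i => v i))
    (hF : ContinuousOn (fun p : ℝ × ℝ => F p.1 p.2) (Icc a b ×ˢ Icc c d)) {x x' : ℝ}
    (hx : x ∈ Icc a b) (hx' : x' ∈ Icc a b) :
    HasSum (fun i : {k : ℕ // (k : ℕ∞) < N} =>
      (σ i * singularFn (volume.restrict (Icc c d)) F σ v i x) *
        (σ i * singularFn (volume.restrict (Icc c d)) F σ v i x'))
      (kernelOne F (Icc c d) x x') := by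
  have h1 := (innerSL ℝ ((memLp_section hF hx').toLp _)).hasSum (hasSum_section hab h hF hx)
  convert! h1 using 1
  · funext i
    have hs : 0 < σ i := h.pos i
    rw [innerSL_apply_apply, inner_smul_right, inner_toLp_left]
    congr 1
    rw [singularFn, mul_inv_cancel_left₀ hs.ne']
  · rw [innerSL_apply_apply, inner_toLp_left]
    refine integral_congr_ae ?_
    filter_upwards [(memLp_section hF hx).coeFn_toLp] with y hy
    rw [hy, mul_comm]

theorem seriesConvergesUniformlyTo_kernelOne (hab : a < b)
    (h : IsSingularSystem (volume.restrict (Icc a b)) (volume.restrict (Icc c d)) F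
      (fun i : {k : ℕ // (k : ℕ∞) < N} => σ i) (fun i => u i) (fun i => v i))
    (hF : ContinuousOn (fun p : ℝ × ℝ => F p.1 p.2) (Icc a b ×ˢ Icc c d)) :
    SeriesConvergesUniformlyTo N (fun k (p : ℝ × ℝ) => σ k ^ 2 *
        singularFn (volume.restrict (Icc c d)) F σ v k p.1 *
        singularFn (volume.restrict (Icc c d)) F σ v k p.2)
      (fun p => kernelOne F (Icc c d) p.1 p.2) (Icc a b ×ˢ Icc a b) ∧
    ∃ G : ℝ × ℝ → ℝ, SeriesConvergesUniformlyTo N (fun k (p : ℝ × ℝ) => |σ k ^ 2 *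
        singularFn (volume.restrict (Icc c d)) F σ v k p.1 *
        singularFn (volume.restrict (Icc c d)) F σ v k p.2|) G (Icc a b ×ˢ Icc a b) := by
  classical
  let φ := singularFn (volume.restrict (Icc c d)) F σ v
  let g : ℕ → ℝ → ℝ := fun k x => if (k : ℕ∞) < N then σ k * φ k x else 0
  have hg : ∀ k, ContinuousOn (g k) (Icc a b) := fun k => by
    by_cases hk : (k : ℕ∞) < N
    · simp only [g, hk, if_true]
      exact continuousOn_const.mul (continuousOn_singularFn hF k)
    · simp only [g, hk, if_false]
      exact continuousOn_const
  have hgg : ∀ k x x', g k x * g k x' =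
      if (k : ℕ∞) < N then σ k ^ 2 * φ k x * φ k x' else 0 := fun k x x' => by
    simp only [g]
    split_ifs <;> ring
  have hsum : ∀ x ∈ Icc a b, ∀ x' ∈ Icc a b,
      HasSum (fun k => g k x * g k x') (kernelOne F (Icc c d) x x') := fun x hx x' hx' => by
    have h1 : HasSum ({k : ℕ | (k : ℕ∞) < N}.indicator
        fun k => (σ k * φ k x) * (σ k * φ k x')) (kernelOne F (Icc c d) x x') :=
      hasSum_subtype_iff_indicator.1 (hasSum_kernelOne hab h hF hx hx')
    convert! h1 using 2 with k
    by_cases hk : (k : ℕ∞) < N <;> simp [g, hk]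
  obtain ⟨h1, G, h2⟩ := tendstoUniformlyOn_sum_mul isCompact_Icc hg (continuousOn_kernelOne hF) hsum
  refine ⟨?_, G, ?_⟩
  · unfold SeriesConvergesUniformlyTo
    convert! h1 using 3 with n p
    rw [partialSum, Finset.sum_filter]
    exact Finset.sum_congr rfl fun k _ => (hgg _ _ _).symm
  · unfold SeriesConvergesUniformlyTo
    convert! h2 using 3 with n p
    rw [partialSum, Finset.sum_filter]
    refine Finset.sum_congr rfl fun k _ => ?_
    rw [hgg]
    split_ifs <;> simp [φ]

/-- If the expansion of a continuous kernel converges uniformly, its sum is the kernel: on each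
section the limit is continuous and agrees almost everywhere with the limit in `L²`. -/
theorem tendsto_partialSum_kernel (hab : a < b) (hcd : c < d)
    (h : IsSingularSystem (volume.restrict (Icc a b)) (volume.restrict (Icc c d)) F
      (fun i : {k : ℕ // (k : ℕ∞) < N} => σ i) (fun i => u i) (fun i => v i))
    (hF : ContinuousOn (fun p : ℝ × ℝ => F p.1 p.2) (Icc a b ×ˢ Icc c d)) {g : ℝ × ℝ → ℝ}
    (hg : SeriesConvergesUniformlyTo N (fun k (p : ℝ × ℝ) => σ k *
        singularFn (volume.restrict (Icc c d)) F σ v k p.1 *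
        singularFn (volume.restrict (Icc a b)) (fun y x => F x y) σ u k p.2)
      g (Icc a b ×ˢ Icc c d)) {x y : ℝ} (hx : x ∈ Icc a b) (hy : y ∈ Icc c d) :
    Tendsto (fun n => partialSum N (fun k (p : ℝ × ℝ) => σ k *
        singularFn (volume.restrict (Icc c d)) F σ v k p.1 *
        singularFn (volume.restrict (Icc a b)) (fun y x => F x y) σ u k p.2) n (x, y))
      atTop (𝓝 (F x y)) := by
  have hF' : ContinuousOn (fun p : ℝ × ℝ => F p.2 p.1) (Icc c d ×ˢ Icc a b) :=
    hF.comp continuous_swap.continuousOn fun p hp => ⟨hp.2, hp.1⟩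
  let φ := singularFn (volume.restrict (Icc c d)) F σ v
  let ψ := singularFn (volume.restrict (Icc a b)) (fun y x => F x y) σ u
  have hψ : ∀ k, ContinuousOn (ψ k) (Icc c d) := fun k =>
    continuousOn_singularFn (F := fun y x => F x y) hF' k
  let P : ℕ → ℝ → ℝ := fun n t =>
    ∑ k ∈ (Finset.range n).filter (fun k : ℕ => (k : ℕ∞) < N), σ k * φ k x * ψ k t
  have hunif : TendstoUniformlyOn P (fun t => g (x, t)) atTop (Icc c d) :=
    (hg.comp (fun t => (x, t))).mono fun t ht => ⟨hx, ht⟩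
  have hgc : ContinuousOn (fun t => g (x, t)) (Icc c d) :=
    hunif.continuousOn (Frequently.of_forall fun n =>
      continuousOn_finsetSum _ fun k _ => continuousOn_const.mul (hψ k))
  have hL2 : Tendsto (fun n => eLpNorm (P n - F x) 2 (volume.restrict (Icc c d)))
      atTop (𝓝 0) := by
    have h1 := tendsto_eLpNorm_sub_partialSum (N := N)
      (G := fun k => (σ k * φ k x) • v k) (f := fun k t => σ k * φ k x * ψ k t)
      (memLp_section hF hx).coeFn_toLp (fun k hk => ?_) (hasSum_section hab h hF hx)
    · convert! h1 using 2 with n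
      exact eLpNorm_sub_comm _ _ _ _
    · filter_upwards [Lp.coeFn_smul (σ k * φ k x) (v k), ae_eq_singularFn h.symm hk] with t h1 h2
      rw [h1, Pi.smul_apply, h2, smul_eq_mul]
  have hPm : ∀ n, AEStronglyMeasurable (P n) (volume.restrict (Icc c d)) := fun n =>
    (continuousOn_finsetSum _ fun k _ => continuousOn_const.mul (hψ k)).aestronglyMeasurable
      measurableSet_Icc
  obtain ⟨ns, hns, hae⟩ := (tendstoInMeasure_of_tendsto_eLpNorm (by norm_num) hPm
    (memLp_section hF hx).1 hL2).exists_seq_tendsto_ae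
  have heq : (fun t => g (x, t)) =ᵐ[volume.restrict (Icc c d)] F x := by
    filter_upwards [hae, ae_restrict_mem measurableSet_Icc] with t h1 ht
    exact tendsto_nhds_unique ((hunif.tendsto_at ht).comp hns.tendsto_atTop) h1
  have hFx : ContinuousOn (F x) (Icc c d) :=
    hF.comp (f := fun y => (x, y)) (by fun_prop) fun y hy => ⟨hx, hy⟩
  have h2 := eqOn_Icc_of_ae_eq hcd heq hgc hFx hy
  have h3 := hunif.tendsto_at hy
  rw [show g (x, y) = F x y from h2] at h3
  exact h3

end ContinuousKernel

end

end FSVD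

/-! ### The singular value decomposition -/

theorem theorem1 (a b c d : ℝ) (hab : a < b) (hcd : c < d) (μ : ℝ → ℝ → ℝ)
    (hμ : MemLp (fun p : ℝ × ℝ => μ p.1 p.2) 2 (volume.restrict (Icc a b ×ˢ Icc c d))) :
    ∃ (N : ℕ∞) (lam : ℕ → ℝ) (φ ψ : ℕ → ℝ → ℝ),
      -- positive, non-increasing
      (∀ k : ℕ, (k : ℕ∞) < N → 0 < lam k) ∧
      (∀ j k : ℕ, j ≤ k → (k : ℕ∞) < N → lam k ≤ lam j) ∧
      -- orthonormal eigenfunctions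
      FSVD.IsOrthonormalSeq N φ (Icc a b) ∧
      FSVD.IsOrthonormalSeq N ψ (Icc c d) ∧
      (∀ k : ℕ, (k : ℕ∞) < N →
        FSVD.IsEigenfunction (FSVD.kernelOne μ (Icc c d)) (Icc a b) (lam k) (φ k)) ∧
      (∀ k : ℕ, (k : ℕ∞) < N →
        FSVD.IsEigenfunction (FSVD.kernelTwo μ (Icc a b)) (Icc c d) (lam k) (ψ k)) ∧
      -- expansions in the sense of the norm of L²
      FSVD.SeriesConvergesL2 N (fun k p => lam k * φ k p.1 * φ k p.2)
        (fun p => FSVD.kernelOne μ (Icc c d) p.1 p.2) (Icc a b ×ˢ Icc a b) ∧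
      FSVD.SeriesConvergesL2 N (fun k p => lam k * ψ k p.1 * ψ k p.2)
        (fun p => FSVD.kernelTwo μ (Icc a b) p.1 p.2) (Icc c d ×ˢ Icc c d) ∧
      FSVD.SeriesConvergesL2 N (fun k p => Real.sqrt (lam k) * φ k p.1 * ψ k p.2)
        (fun p => μ p.1 p.2) (Icc a b ×ˢ Icc c d) ∧
      -- the continuous case
      (ContinuousOn (fun p : ℝ × ℝ => μ p.1 p.2) (Icc a b ×ˢ Icc c d) →
        (∀ k : ℕ, (k : ℕ∞) < N → ContinuousOn (φ k) (Icc a b)) ∧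
        (∀ k : ℕ, (k : ℕ∞) < N → ContinuousOn (ψ k) (Icc c d)) ∧
        -- uniform convergence to the kernels, and of the series of absolute values
        FSVD.SeriesConvergesUniformlyTo N (fun k (p : ℝ × ℝ) => lam k * φ k p.1 * φ k p.2)
          (fun p => FSVD.kernelOne μ (Icc c d) p.1 p.2) (Icc a b ×ˢ Icc a b) ∧
        (∃ G : ℝ × ℝ → ℝ,
          FSVD.SeriesConvergesUniformlyTo N (fun k (p : ℝ × ℝ) => |lam k * φ k p.1 * φ k p.2|)
            G (Icc a b ×ˢ Icc a b)) ∧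
        FSVD.SeriesConvergesUniformlyTo N (fun k (p : ℝ × ℝ) => lam k * ψ k p.1 * ψ k p.2)
          (fun p => FSVD.kernelTwo μ (Icc a b) p.1 p.2) (Icc c d ×ˢ Icc c d) ∧
        (∃ G : ℝ × ℝ → ℝ,
          FSVD.SeriesConvergesUniformlyTo N (fun k (p : ℝ × ℝ) => |lam k * ψ k p.1 * ψ k p.2|)
            G (Icc c d ×ˢ Icc c d)) ∧
        -- the pointwise identity for `μ`
        ((∃ g : ℝ × ℝ → ℝ,
            FSVD.SeriesConvergesUniformlyTo N
              (fun k (p : ℝ × ℝ) => Real.sqrt (lam k) * φ k p.1 * ψ k p.2)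
              g (Icc a b ×ˢ Icc c d)) →
          FSVD.SeriesConvergesAbsolutely N
            (fun k (p : ℝ × ℝ) => Real.sqrt (lam k) * φ k p.1 * ψ k p.2)
            (Icc a b ×ˢ Icc c d) →
          ∀ s ∈ Icc a b, ∀ t ∈ Icc c d,
            Tendsto (fun n => FSVD.partialSum N
              (fun k (p : ℝ × ℝ) => Real.sqrt (lam k) * φ k p.1 * ψ k p.2) n (s, t))
              atTop (𝓝 (μ s t)))) := by
  rw [Measure.volume_eq_prod, ← Measure.prod_restrict] at hμ
  obtain ⟨N, σ, u, v, hσ, hanti, h⟩ := FSVD.exists_isSingularSystem hμ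
  have hμ' := FSVD.memLp_swap hμ
  have hpos : ∀ k : ℕ, (k : ℕ∞) < N → 0 < σ k := fun k hk => h.pos ⟨k, hk⟩
  have hsqrt : ∀ k, Real.sqrt (σ k ^ 2) = σ k := fun k => Real.sqrt_sq (hσ k)
  refine ⟨N, fun k => σ k ^ 2, FSVD.singularFn (volume.restrict (Icc c d)) μ σ v,
    FSVD.singularFn (volume.restrict (Icc a b)) (fun t s => μ s t) σ u,
    fun k hk => pow_pos (hpos k hk) 2,
    fun j k hjk hk => pow_le_pow_left₀ (hσ k) (hanti j k hjk hk) 2,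
    FSVD.isOrthonormalSeq_singularFn h, FSVD.isOrthonormalSeq_singularFn h.symm,
    fun k hk => FSVD.isEigenfunction_singularFn h hμ hk,
    fun k hk => FSVD.isEigenfunction_singularFn h.symm hμ' hk,
    FSVD.seriesConvergesL2_kernelOne h hμ, FSVD.seriesConvergesL2_kernelOne h.symm hμ', ?_,
    fun hc => ?_⟩
  · simp only [hsqrt]
    exact FSVD.seriesConvergesL2_kernel h hμ
  · have hc' : ContinuousOn (fun p : ℝ × ℝ => μ p.2 p.1) (Icc c d ×ˢ Icc a b) :=
      hc.comp continuous_swap.continuousOn fun p hp => ⟨hp.2, hp.1⟩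
    have h1 := FSVD.seriesConvergesUniformlyTo_kernelOne hab h hc
    have h2 := FSVD.seriesConvergesUniformlyTo_kernelOne hcd h.symm hc'
    refine ⟨fun k _ => FSVD.continuousOn_singularFn hc k,
      fun k _ => FSVD.continuousOn_singularFn (F := fun t s => μ s t) hc' k,
      h1.1, h1.2, h2.1, h2.2, ?_⟩
    simp only [hsqrt]
    rintro ⟨g, hg⟩ - s hs t ht
    exact FSVD.tendsto_partialSum_kernel hab hcd h hc hg hs ht
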